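/- Let $n\ge 2$, let $\Omega\subset\mathbb{R}^n$ be a bounded domain (a non-empty connected open set), and write $\rho(x)=d(x,\partial\Omega)$ for $x\in\Omega$. Let $1<p<\infty$ and let $Q\subset\Omega$ be a closed (non-degenerate) cube. Suppose that there is a constant $C$ such that for all $\mathbf{v}\in W^{1,p}(\Omega,\mathbb{R}^n)$ $$\|D\mathbf{v}\|_{L^p(\Omega)}\le C\left\{\|\epsilon(\mathbf{v})\|_{L^p(\Omega)}+\|D\mathbf{v}\|_{L^p(Q)}\right\},\tag{$\widehat K_p$}$$ where $D\mathbf{v}=(\partial v_i/\partial x_j)_{i,j}$ is the distributional gradient matrix, $\epsilon(\mathbf{v})=\frac12(D\mathbf{v}+D\mathbf{v}^T)$ is its symmetric part, and the $L^p$-norms of matrix fields are taken with respect to the matrix norm $|S|=\max_{i,j}|s_{i,j}|$. Suppose further that $\Omega$ has the separation property with respect to a distinguished point $x_0\in\Omega$: there is a constant $C_s\ge 1$ such that for each $x\in\Omega$ there is a continuous curve $\gamma:[0,1]\to\Omega$ with $\gamma(0)=x$, $\gamma(1)=x_0$, such that for each $t\in[0,1]$, with $B$ the closed ball $B(\gamma(t),C_s\,\rho(\gamma(t)))$,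 either $\gamma([0,t])\subset B$, or each $y\in\gamma([0,t])\setminus B$ belongs to a component of $\Omega\setminus\partial B$ that does not contain $x_0$. Then $\Omega$ is a John domain with distinguished point $x_0$: there is a constant $C_J>0$ such that for each $x\in\Omega$ there is a rectifiable curve $\gamma:[0,l]\to\Omega$, parametrised by arclength, with $\gamma(0)=x$, $\gamma(l)=x_0$, and $\rho(\gamma(t))\ge C_J\,t$ for all $t\in[0,l]$. -/

import Mathlib

open MeasureTheory Set
open scoped ENNReal NNReal ContDiff

namespace KornJohn

/-- `ρ(x) = d(x, ∂Ω)`. -/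
noncomputable def bdryDist {n : ℕ} (Ω : Set (EuclideanSpace ℝ (Fin n)))
    (x : EuclideanSpace ℝ (Fin n)) : ℝ :=
  Metric.infDist x (frontier Ω)

/-- The domain `Ω` with distinguished point `x₀` is a John domain: every point `x` of `Ω` can be
joined to `x₀` inside `Ω` by a rectifiable curve `γ : [0, l] → Ω`, parametrised by arclength
(hence continuous), such that `ρ(γ(t)) ≥ C t`; the constant `C > 0` does not depend on `x`. -/
def IsJohn {n : ℕ} (Ω : Set (EuclideanSpace ℝ (Fin n)))
    (x₀ : EuclideanSpace ℝ (Fin n)) : Prop :=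
  x₀ ∈ Ω ∧ ∃ C : ℝ, 0 < C ∧ ∀ x ∈ Ω,
    ∃ (l : ℝ) (γ : ℝ → EuclideanSpace ℝ (Fin n)), 0 ≤ l ∧
      HasUnitSpeedOn γ (Icc 0 l) ∧ γ 0 = x ∧ γ l = x₀ ∧
      ∀ t ∈ Icc 0 l, γ t ∈ Ω ∧ C * t ≤ bdryDist Ω (γ t)

/-- The domain `Ω` with distinguished point `x₀` has the separation property. With
`B = B(γ(t), C ρ(γ(t)))` the closed ball, either `γ([0, t]) ⊆ B`, or every point `y` of
`γ([0, t]) \ B` lies in a component of `Ω \ ∂B` that does not contain `x₀`. -/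
def HasSeparationProperty {n : ℕ} (Ω : Set (EuclideanSpace ℝ (Fin n)))
    (x₀ : EuclideanSpace ℝ (Fin n)) : Prop :=
  x₀ ∈ Ω ∧ ∃ C : ℝ, 1 ≤ C ∧ ∀ x ∈ Ω,
    ∃ γ : ℝ → EuclideanSpace ℝ (Fin n),
      ContinuousOn γ (Icc 0 1) ∧ MapsTo γ (Icc 0 1) Ω ∧ γ 0 = x ∧ γ 1 = x₀ ∧
      ∀ t ∈ Icc (0 : ℝ) 1,
        γ '' Icc 0 t ⊆ Metric.closedBall (γ t) (C * bdryDist Ω (γ t)) ∨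
        ∀ y ∈ γ '' Icc 0 t \ Metric.closedBall (γ t) (C * bdryDist Ω (γ t)),
          x₀ ∉ connectedComponentIn (Ω \ Metric.sphere (γ t) (C * bdryDist Ω (γ t))) y

/-- A closed cube: a congruent copy of `[-s, s]ⁿ` for some `s > 0`. -/
def IsClosedCube {n : ℕ} (Q : Set (EuclideanSpace ℝ (Fin n))) : Prop :=
  ∃ (e : EuclideanSpace ℝ (Fin n) ≃ᵢ EuclideanSpace ℝ (Fin n)) (s : ℝ), 0 < s ∧
    Q = e '' {x | ∀ i, |x i| ≤ s}

/-- `g` is the weak (distributional) `j`-th partial derivative of `f` on `Ω`. -/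
def IsWeakPartialDeriv {n : ℕ} (Ω : Set (EuclideanSpace ℝ (Fin n))) (j : Fin n)
    (f g : EuclideanSpace ℝ (Fin n) → ℝ) : Prop :=
  ∀ φ : EuclideanSpace ℝ (Fin n) → ℝ, ContDiff ℝ ∞ φ → HasCompactSupport φ → tsupport φ ⊆ Ω →
    ∫ x in Ω, f x * fderiv ℝ φ x (EuclideanSpace.single j 1) = - ∫ x in Ω, g x * φ x

/-- `u` is in `W^{1,p}(Ω, ℝⁿ)` and `Du` is its weak gradient matrix, `(Du x) i j = ∂uᵢ/∂xⱼ`.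
The norm of `Fin n → Fin n → ℝ` is the maximum of the absolute values of the entries. -/
structure IsSobolevField {n : ℕ} (Ω : Set (EuclideanSpace ℝ (Fin n))) (p : ℝ≥0∞)
    (u : EuclideanSpace ℝ (Fin n) → EuclideanSpace ℝ (Fin n))
    (Du : EuclideanSpace ℝ (Fin n) → Fin n → Fin n → ℝ) : Prop where
  memLp : MemLp u p (volume.restrict Ω)
  memLp_grad : MemLp Du p (volume.restrict Ω)
  weak_deriv : ∀ i j, IsWeakPartialDeriv Ω j (fun x => u x i) (fun x => Du x i j)

/-- The symmetric part of a square matrix. -/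
noncomputable def symmPart {n : ℕ} (A : Fin n → Fin n → ℝ) : Fin n → Fin n → ℝ :=
  fun i j => (A i j + A j i) / 2

/-- The Korn inequality on `Ω`, with the additional term `‖Du‖_{L^p(Q)}`: for one constant `C`,
`‖Du‖_{L^p(Ω)} ≤ C (‖ε(u)‖_{L^p(Ω)} + ‖Du‖_{L^p(Q)})` for all `u` in `W^{1,p}(Ω, ℝⁿ)`. -/
def KornInequality {n : ℕ} (Ω Q : Set (EuclideanSpace ℝ (Fin n))) (p : ℝ≥0∞) : Prop :=
  ∃ C : ℝ≥0, ∀ u Du, IsSobolevField Ω p u Du →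
    eLpNorm Du p (volume.restrict Ω) ≤
      C * (eLpNorm (fun x => symmPart (Du x)) p (volume.restrict Ω) +
        eLpNorm Du p (volume.restrict Q))

end KornJohn

/-!
The argument has two halves, joined by the following property of the curves `γ` given by the
separation condition: the part of `γ` before the time `t` stays within `M ρ(γ(t))` of `γ(t)`,
with `M` independent of the curve (`exists_dist_le_bdryDist_of_separation`).

*From Korn to this property.* Let `z ∈ Ω`, `r = C ρ(z)`, and let `T` be a component of `Ω \ ∂B(z, r)`
that does not contain `x₀`. Take a rotation about `z` that is cut off between the radii `r` and `2r`
and set to zero outside `T`. This field is Sobolev, its symmetric gradient is bounded by a constant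
and supported in `B(z, 2r)`, and its gradient has norm `1` on `T \ B(z, 2r)`. If `T` misses `Q`, the
Korn inequality therefore gives `|T \ B(z, 2r)| ≤ K rⁿ` (`KornInequality.exists_volume_tail_le`).
If `T` meets `Q`, then `z` is far from the boundary and the bound is trivial. Now follow `γ` backwards
from `γ(t)` to an earlier point `y = γ(s)`, always moving to the last point at distance `4C ρ(z_k)`
from the current point `z_k` (`exists_chain`). The balls `B(z_j, ρ(z_j)/4)` with `j > k` are disjoint
and lie in the component of `y` in `Ω \ ∂B(z_k, C ρ(z_k))`, outside `B(z_k, 2C ρ(z_k))`, and by the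
separation condition this component does not contain `x₀`. Hence
`∑_{j > k} ρ(z_j)ⁿ ≤ K' ρ(z_k)ⁿ` for each `k`. Such sums decay geometrically, so that
`∑_k ρ(z_k)` is bounded by a multiple of `ρ(γ(t))` (`exists_sum_le_of_sum_pow_le`), and this sum
bounds the distance from `γ(t)` to `y`.

*From this property to the John condition.* Follow `γ` forwards with steps `ρ(z_k)/2`. The balls
`B(z_j, ρ(z_j)/8)` with `j < k` are disjoint and lie in a ball around `z_k` of radius comparable to
`ρ(z_k)`, so the same summation lemma bounds `∑_{j ≤ k} ρ(z_j)` by a multiple of `ρ(z_k)`. The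
polygonal curve with vertices `z_k`, parametrised by arclength, is the required John curve
(`isJohn_of_dist_le_bdryDist`).
-/

namespace KornJohn

open Filter Topology

/-! ### Sobolev fields cut off along an open set -/

section TestField

variable {n : ℕ}

theorem integral_fderiv_eq_zero {F : EuclideanSpace ℝ (Fin n) → ℝ} (hF : ContDiff ℝ 1 F)
    (hc : HasCompactSupport F) (e : EuclideanSpace ℝ (Fin n)) :
    ∫ x, fderiv ℝ F x e = 0 := by
  have hint : Integrable (fun x => fderiv ℝ F x e) :=
    ((hF.continuous_fderiv (by norm_num)).clm_apply continuous_const).integrable_of_hasCompactSupport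
      (hc.fderiv_apply ℝ e)
  have hintF : Integrable F := hF.continuous.integrable_of_hasCompactSupport hc
  have := integral_mul_fderiv_eq_neg_fderiv_mul_of_integrable (μ := volume)
    (f := fun _ : EuclideanSpace ℝ (Fin n) => (1 : ℝ)) (g := F) (v := e)
    (by simp) (by simpa using hint) (by simpa using hintF)
    (by fun_prop) (fun x _ => hF.differentiable (by norm_num) x)
  simpa using this

section Indicator

variable {Ω T : Set (EuclideanSpace ℝ (Fin n))}
  {w : EuclideanSpace ℝ (Fin n) → EuclideanSpace ℝ (Fin n)}

/-- Setting a `C¹` field `w` to zero outside an open set `T` preserves weak differentiability in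
`Ω`, provided that `w` vanishes in `T` near each point of `Ω \ T`: the truncated field is then
still `C¹` in `Ω`. -/
theorem isWeakPartialDeriv_indicator (hT : IsOpen T) (hw : ContDiff ℝ 1 w)
    (hloc : ∀ x ∈ Ω, x ∉ T → ∀ᶠ y in 𝓝 x, y ∈ T → w y = 0) (i j : Fin n) :
    IsWeakPartialDeriv Ω j (fun x => T.indicator w x i)
      (fun x => T.indicator (fun x i j => fderiv ℝ w x (EuclideanSpace.single j 1) i) x i j) := by
  intro φ hφ hφc hφΩ
  set e : EuclideanSpace ℝ (Fin n) := EuclideanSpace.single j 1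
  have hφ1 : ContDiff ℝ 1 φ := hφ.of_le (by exact_mod_cast le_top)
  have hwi : ContDiff ℝ 1 (fun x => w x i) := by fun_prop
  have hdwi : ∀ x, fderiv ℝ (fun x => w x i) x e = fderiv ℝ w x e i := by
    intro x
    have h := (hw.differentiable (by norm_num) x).hasFDerivAt
    have h2 := ((EuclideanSpace.proj (𝕜 := ℝ) i).hasFDerivAt (x := w x)).comp x h
    exact congrArg (fun L => L e) h2.fderiv
  -- the product of the field and the test function is a `C¹` function on the whole space
  set G : EuclideanSpace ℝ (Fin n) → ℝ := fun x => w x i * φ x with hGdef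
  have hG : ContDiff ℝ 1 G := hwi.mul hφ1
  have hzero : ∀ x, x ∉ tsupport φ → T.indicator G =ᶠ[𝓝 x] 0 := by
    intro x hx
    have : ∀ᶠ y in 𝓝 x, φ y = 0 := notMem_tsupport_iff_eventuallyEq.1 hx
    filter_upwards [this] with y hy
    by_cases hyT : y ∈ T <;> simp [hyT, G, hy]
  have hcases : ∀ x, (x ∈ T ∧ T.indicator G =ᶠ[𝓝 x] G) ∨ (x ∉ T ∧ T.indicator G =ᶠ[𝓝 x] 0) := by
    intro x
    by_cases hxT : x ∈ T
    · left
      refine ⟨hxT, ?_⟩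
      filter_upwards [hT.mem_nhds hxT] with y hy
      simp [hy]
    · right
      refine ⟨hxT, ?_⟩
      by_cases hx : x ∈ tsupport φ
      · filter_upwards [hloc x (hφΩ hx) hxT] with y hy
        by_cases hyT : y ∈ T
        · simp [hyT, G, hy hyT]
        · simp [hyT]
      · exact hzero x hx
  have hF : ContDiff ℝ 1 (T.indicator G) := by
    rw [contDiff_iff_contDiffAt]
    intro x
    rcases hcases x with ⟨-, h⟩ | ⟨-, h⟩
    · exact hG.contDiffAt.congr_of_eventuallyEq h
    · exact contDiffAt_const.congr_of_eventuallyEq h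
  have hFc : HasCompactSupport (T.indicator G) := by
    refine HasCompactSupport.of_support_subset_isCompact hφc.isCompact ?_
    intro x hx
    by_contra hxn
    exact hx (by simpa using (hzero x hxn).self_of_nhds)
  have hdF : ∀ x, fderiv ℝ (T.indicator G) x e
      = T.indicator (fun x => w x i * fderiv ℝ φ x e) x
        + T.indicator (fun x => fderiv ℝ w x e i * φ x) x := by
    intro x
    rcases hcases x with ⟨hx, h⟩ | ⟨hx, h⟩
    · rw [h.fderiv_eq, hGdef]
      have := fderiv_fun_mul (hwi.differentiable (by norm_num) x) (hφ1.differentiable (by norm_num) x)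
      rw [this]
      simp only [hx, indicator_of_mem, add_apply, FunLike.coe_smul,
        Pi.smul_apply, smul_eq_mul, hdwi]
      ring
    · rw [h.fderiv_eq]
      simp [hx]
  have hint1 : Integrable (T.indicator (fun x => w x i * fderiv ℝ φ x e)) := by
    refine Integrable.indicator (Continuous.integrable_of_hasCompactSupport ?_ ?_) hT.measurableSet
    · exact hwi.continuous.mul ((hφ1.continuous_fderiv (by norm_num)).clm_apply continuous_const)
    · exact (hφc.fderiv_apply ℝ e).mul_left
  have hint2 : Integrable (T.indicator (fun x => fderiv ℝ w x e i * φ x)) := by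
    refine Integrable.indicator (Continuous.integrable_of_hasCompactSupport ?_ ?_) hT.measurableSet
    · have : Continuous fun x => fderiv ℝ w x e :=
        (hw.continuous_fderiv (by norm_num)).clm_apply continuous_const
      have h2 : Continuous fun x => fderiv ℝ w x e i := by fun_prop
      exact h2.mul hφ1.continuous
    · exact hφc.mul_left
  have hφ0 : ∀ x, x ∉ Ω → φ x = 0 := fun x hx =>
    image_eq_zero_of_notMem_tsupport fun h => hx (hφΩ h)
  have hdφ0 : ∀ x, x ∉ Ω → fderiv ℝ φ x e = 0 := fun x hx => by
    rw [fderiv_of_notMem_tsupport (𝕜 := ℝ) (f := φ) (x := x) fun h => hx (hφΩ h)]; simp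
  rw [setIntegral_eq_integral_of_forall_compl_eq_zero (fun x hx => by simp [hdφ0 x hx]),
    setIntegral_eq_integral_of_forall_compl_eq_zero (fun x hx => by simp [hφ0 x hx]),
    eq_neg_iff_add_eq_zero]
  have key := integral_fderiv_eq_zero hF hFc e
  simp_rw [hdF] at key
  rw [integral_add hint1 hint2] at key
  rw [← key]
  congr 1 <;> refine integral_congr_ae (ae_of_all _ fun x => ?_) <;>
    by_cases hx : x ∈ T <;> simp [hx, e]

theorem memLp_indicator_of_continuous {F : Type*} [NormedAddCommGroup F]
    [SecondCountableTopology F] {p : ℝ≥0∞} {f : EuclideanSpace ℝ (Fin n) → F}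
    (hΩ : Bornology.IsBounded Ω) (hΩm : MeasurableSet Ω) (hT : MeasurableSet T)
    (hf : Continuous f) : MemLp (T.indicator f) p (volume.restrict Ω) := by
  have : IsFiniteMeasure (volume.restrict Ω) := ⟨by simpa using hΩ.measure_lt_top⟩
  obtain ⟨C, hC⟩ := (hΩ.isCompact_closure.image hf).isBounded.exists_norm_le
  refine MemLp.of_bound (hf.aestronglyMeasurable.indicator hT) C ?_
  filter_upwards [ae_restrict_mem hΩm] with x hx
  exact (norm_indicator_le_norm_self f x).trans (hC _ (mem_image_of_mem f (subset_closure hx)))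

theorem isSobolevField_indicator {p : ℝ≥0∞} (hΩ : IsOpen Ω) (hΩb : Bornology.IsBounded Ω)
    (hT : IsOpen T) (hw : ContDiff ℝ 1 w)
    (hloc : ∀ x ∈ Ω, x ∉ T → ∀ᶠ y in 𝓝 x, y ∈ T → w y = 0) :
    IsSobolevField Ω p (T.indicator w)
      (T.indicator fun x i j => fderiv ℝ w x (EuclideanSpace.single j 1) i) where
  memLp := memLp_indicator_of_continuous hΩb hΩ.measurableSet hT.measurableSet hw.continuous
  memLp_grad := by
    refine memLp_indicator_of_continuous hΩb hΩ.measurableSet hT.measurableSet ?_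
    refine continuous_pi fun i => continuous_pi fun j => ?_
    have : Continuous fun x => fderiv ℝ w x (EuclideanSpace.single j 1) :=
      (hw.continuous_fderiv (by norm_num)).clm_apply continuous_const
    fun_prop
  weak_deriv := isWeakPartialDeriv_indicator hT hw hloc

end Indicator

/-! ### A smooth cutoff at a given scale -/

theorem exists_bound_deriv_smoothTransition :
    ∃ M : ℝ, 0 ≤ M ∧ ∀ s, |deriv Real.smoothTransition s| ≤ M := by
  have hcont : Continuous (deriv Real.smoothTransition) :=
    (Real.smoothTransition.contDiff (n := 1)).continuous_deriv (by norm_num)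
  obtain ⟨M, hM⟩ := (isCompact_Icc (a := (0 : ℝ)) (b := 1)).exists_bound_of_continuousOn
    hcont.continuousOn
  refine ⟨M, (norm_nonneg _).trans (hM 0 (by simp)), fun s => ?_⟩
  have hM0 : 0 ≤ M := (norm_nonneg _).trans (hM 0 (by simp))
  rcases lt_or_ge s 0 with hs | hs
  · have : Real.smoothTransition =ᶠ[𝓝 s] fun _ => 0 := by
      filter_upwards [Iio_mem_nhds hs] with y hy
      exact Real.smoothTransition.zero_of_nonpos (le_of_lt hy)
    rw [this.deriv_eq]; simpa
  rcases lt_or_ge 1 s with hs1 | hs1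
  · have : Real.smoothTransition =ᶠ[𝓝 s] fun _ => 1 := by
      filter_upwards [Ioi_mem_nhds hs1] with y hy
      exact Real.smoothTransition.one_of_one_le (le_of_lt hy)
    rw [this.deriv_eq]; simpa
  exact hM s ⟨hs, hs1⟩

/-- A smooth cutoff around `z` at scale `r`: it vanishes for `‖x - z‖² ≤ 2r²`, in particular near
the closed ball of radius `r`, and is `1` for `‖x - z‖² ≥ 3r²`, in particular outside the ball of
radius `2r`. -/
noncomputable def cutoff (z : EuclideanSpace ℝ (Fin n)) (r : ℝ) (x : EuclideanSpace ℝ (Fin n)) :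
    ℝ :=
  Real.smoothTransition (‖x - z‖ ^ 2 / r ^ 2 - 2)

section Cutoff

variable {z x : EuclideanSpace ℝ (Fin n)} {r : ℝ}

theorem contDiff_cutoff : ContDiff ℝ 1 (cutoff z r) :=
  Real.smoothTransition.contDiff.comp
    ((((contDiff_id.sub contDiff_const).norm_sq ℝ).div_const _).sub contDiff_const)

theorem cutoff_eq_zero (hr : 0 < r) (hx : ‖x - z‖ ^ 2 ≤ 2 * r ^ 2) : cutoff z r x = 0 := by
  apply Real.smoothTransition.zero_of_nonpos
  have : ‖x - z‖ ^ 2 / r ^ 2 ≤ 2 := (div_le_iff₀ (by positivity)).2 hx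
  linarith

theorem cutoff_eq_one (hr : 0 < r) (hx : 3 * r ^ 2 ≤ ‖x - z‖ ^ 2) : cutoff z r x = 1 := by
  apply Real.smoothTransition.one_of_one_le
  have : 3 ≤ ‖x - z‖ ^ 2 / r ^ 2 := (le_div_iff₀ (by positivity)).2 hx
  linarith

theorem norm_fderiv_cutoff_le {M : ℝ} (hM : ∀ s, |deriv Real.smoothTransition s| ≤ M) :
    ‖fderiv ℝ (cutoff z r) x‖ ≤ M * (2 * ‖x - z‖ / r ^ 2) := by
  have hg : HasFDerivAt (fun x : EuclideanSpace ℝ (Fin n) => ‖x - z‖ ^ 2 / r ^ 2 - 2)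
      ((r ^ 2)⁻¹ • (2 • innerSL ℝ (x - z))) x := by
    have h1 := (hasStrictFDerivAt_norm_sq (x - z)).hasFDerivAt.comp x
      ((hasFDerivAt_id x).sub_const z)
    have h2 := (h1.const_smul ((r ^ 2)⁻¹)).sub_const 2
    refine h2.congr_of_eventuallyEq (Eventually.of_forall fun y => ?_) |>.congr_fderiv ?_
    · simp [div_eq_inv_mul]
    · ext; simp
  have hs : HasDerivAt Real.smoothTransition
      (deriv Real.smoothTransition (‖x - z‖ ^ 2 / r ^ 2 - 2)) (‖x - z‖ ^ 2 / r ^ 2 - 2) :=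
    ((Real.smoothTransition.contDiff (n := 1)).differentiable (by norm_num) _).hasDerivAt
  have h := hs.comp_hasFDerivAt x hg
  have hM0 : 0 ≤ M := (abs_nonneg _).trans (hM 0)
  have h' : fderiv ℝ (cutoff z r) x = _ := h.fderiv
  rw [h', norm_smul, norm_smul, Real.norm_eq_abs]
  refine mul_le_mul (hM _) ?_ (by positivity) hM0
  have : ‖(2 • innerSL ℝ (x - z) : EuclideanSpace ℝ (Fin n) →L[ℝ] ℝ)‖ ≤ 2 * ‖x - z‖ := by
    refine (norm_nsmul_le).trans ?_
    rw [innerSL_apply_norm]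
    simp
  rw [norm_inv, Real.norm_eq_abs, abs_of_nonneg (by positivity), div_eq_inv_mul]
  exact mul_le_mul_of_nonneg_left this (by positivity)

end Cutoff

/-! ### Cut-off rotations and the Korn inequality -/

/-- The field `x ↦ η(x) A(x - z)`: an infinitesimal motion with linear part `A`, cut off near
`z`. -/
noncomputable def cutoffMotion
    (A : EuclideanSpace ℝ (Fin n) →L[ℝ] EuclideanSpace ℝ (Fin n))
    (z : EuclideanSpace ℝ (Fin n)) (r : ℝ) (x : EuclideanSpace ℝ (Fin n)) :
    EuclideanSpace ℝ (Fin n) :=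
  cutoff z r x • A (x - z)

section CutoffMotion

variable {A : EuclideanSpace ℝ (Fin n) →L[ℝ] EuclideanSpace ℝ (Fin n)}
  {z x : EuclideanSpace ℝ (Fin n)} {r : ℝ}

theorem contDiff_cutoffMotion : ContDiff ℝ 1 (cutoffMotion A z r) :=
  contDiff_cutoff.smul (by fun_prop)

theorem fderiv_cutoffMotion_apply (e : EuclideanSpace ℝ (Fin n)) (i : Fin n) :
    fderiv ℝ (cutoffMotion A z r) x e i
      = cutoff z r x * A e i + fderiv ℝ (cutoff z r) x e * A (x - z) i := by
  have h1 : HasFDerivAt (cutoff z r) (fderiv ℝ (cutoff z r) x) x :=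
    (contDiff_cutoff.differentiable (by norm_num) x).hasFDerivAt
  have h2 : HasFDerivAt (fun x => A (x - z)) A x := by
    exact A.hasFDerivAt.comp x ((hasFDerivAt_id x).sub_const z)
  have h : fderiv ℝ (cutoffMotion A z r) x = _ := (h1.smul h2).fderiv
  rw [h]
  simp

/-- The symmetric part of the gradient of a cut-off rotation is bounded independently of the scale,
and it vanishes away from the transition region of the cutoff: the linear part of the rotation is
skew, and only the derivative of the cutoff contributes. -/
theorem abs_symm_fderiv_cutoffMotion_le {M : ℝ}
    (hM : ∀ s, |deriv Real.smoothTransition s| ≤ M) (hr : 0 < r)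
    (hA : ∀ i j, A (EuclideanSpace.single j 1) i = - A (EuclideanSpace.single i 1) j)
    (i j : Fin n) :
    |(fderiv ℝ (cutoffMotion A z r) x (EuclideanSpace.single j 1) i
      + fderiv ℝ (cutoffMotion A z r) x (EuclideanSpace.single i 1) j) / 2|
      ≤ (Metric.closedBall z (2 * r)).indicator (fun _ => 8 * M * ‖A‖) x := by
  have hM0 : 0 ≤ M := (abs_nonneg _).trans (hM 0)
  rw [fderiv_cutoffMotion_apply, fderiv_cutoffMotion_apply, hA i j]
  by_cases hx : x ∈ Metric.closedBall z (2 * r)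
  · rw [indicator_of_mem hx]
    have hd : ‖x - z‖ ≤ 2 * r := by simpa [dist_eq_norm] using hx
    have key : ∀ i j : Fin n,
        |fderiv ℝ (cutoff z r) x (EuclideanSpace.single j 1) * A (x - z) i| ≤ 8 * M * ‖A‖ := by
      intro i j
      rw [abs_mul]
      have h1 : |fderiv ℝ (cutoff z r) x (EuclideanSpace.single j 1)|
          ≤ M * (2 * ‖x - z‖ / r ^ 2) := by
        refine ((fderiv ℝ (cutoff z r) x).le_opNorm _).trans ?_
        simpa using norm_fderiv_cutoff_le hM
      have h2 : |A (x - z) i| ≤ ‖A‖ * ‖x - z‖ :=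
        (PiLp.norm_apply_le (A (x - z)) i).trans (A.le_opNorm _)
      calc _ ≤ M * (2 * ‖x - z‖ / r ^ 2) * (‖A‖ * ‖x - z‖) := by gcongr
        _ ≤ M * (2 * (2 * r) / r ^ 2) * (‖A‖ * (2 * r)) := by gcongr
        _ = 8 * M * ‖A‖ := by field_simp; ring
    have h1 := abs_le.1 (key i j)
    have h2 := abs_le.1 (key j i)
    rw [abs_le]
    constructor <;> linarith [h1.1, h1.2, h2.1, h2.2]
  · rw [indicator_of_notMem hx]
    have hd : 2 * r < ‖x - z‖ := by simpa [dist_eq_norm] using hx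
    have h0 : fderiv ℝ (cutoff z r) x = 0 := by
      have : cutoff z r =ᶠ[𝓝 x] fun _ => 1 := by
        filter_upwards [(isOpen_lt continuous_const
          (continuous_norm.comp (continuous_id.sub continuous_const))).mem_nhds hd] with y hy
        have hy' : 2 * r < ‖y - z‖ := hy
        exact cutoff_eq_one hr (by nlinarith)
      rw [this.fderiv_eq]; simp
    simp [h0]

theorem fderiv_cutoffMotion_of_notMem (hr : 0 < r) (hx : x ∉ Metric.closedBall z (2 * r))
    (e : EuclideanSpace ℝ (Fin n)) : fderiv ℝ (cutoffMotion A z r) x e = A e := by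
  have hd : 2 * r < ‖x - z‖ := by simpa [dist_eq_norm] using hx
  have h : cutoffMotion A z r =ᶠ[𝓝 x] fun x => A (x - z) := by
    filter_upwards [(isOpen_lt continuous_const
      (continuous_norm.comp (continuous_id.sub continuous_const))).mem_nhds hd] with y hy
    have hy' : 2 * r < ‖y - z‖ := hy
    simp [cutoffMotion, cutoff_eq_one hr (show 3 * r ^ 2 ≤ ‖y - z‖ ^ 2 by nlinarith)]
  have h2 : HasFDerivAt (fun x => A (x - z)) A x := by
    exact A.hasFDerivAt.comp x ((hasFDerivAt_id x).sub_const z)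
  rw [h.fderiv_eq, h2.fderiv]

theorem cutoffMotion_eventually_eq_zero (hr : 0 < r) (hx : ‖x - z‖ = r) :
    ∀ᶠ y in 𝓝 x, cutoffMotion A z r y = 0 := by
  have : ‖x - z‖ ^ 2 < 2 * r ^ 2 := by rw [hx]; nlinarith
  filter_upwards [(isOpen_lt (f := fun y => ‖y - z‖ ^ 2) (by fun_prop)
    (continuous_const (y := 2 * r ^ 2))).mem_nhds this] with y hy
  simp [cutoffMotion, cutoff_eq_zero hr (le_of_lt hy)]

end CutoffMotion

/-- A skew linear map with an entry equal to `1`; its existence needs `2 ≤ n`. -/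
theorem exists_skew (hn : 2 ≤ n) : ∃ (A : EuclideanSpace ℝ (Fin n) →L[ℝ] EuclideanSpace ℝ (Fin n)),
    (∀ i j, A (EuclideanSpace.single j 1) i = - A (EuclideanSpace.single i 1) j) ∧
    ∃ i j, A (EuclideanSpace.single j 1) i = 1 := by
  set a : Fin n := ⟨0, by omega⟩
  set b : Fin n := ⟨1, by omega⟩
  have hab : a ≠ b := by simp [a, b]
  refine ⟨(EuclideanSpace.proj (𝕜 := ℝ) b).smulRight (EuclideanSpace.single a 1)
    - (EuclideanSpace.proj (𝕜 := ℝ) a).smulRight (EuclideanSpace.single b 1), ?_, a, b, ?_⟩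
  · intro i j
    by_cases h1 : i = a <;> by_cases h2 : i = b <;> by_cases h3 : j = a <;> by_cases h4 : j = b <;>
      simp_all [eq_comm]
  · simp [hab]

/-- A component of an open set `F` is relatively closed in `F`. -/
theorem eventually_notMem_connectedComponentIn {F : Set (EuclideanSpace ℝ (Fin n))}
    (hF : IsOpen F) {x y : EuclideanSpace ℝ (Fin n)} (hx : x ∈ F)
    (hxy : x ∉ connectedComponentIn F y) : ∀ᶠ w in 𝓝 x, w ∉ connectedComponentIn F y := by
  filter_upwards [hF.connectedComponentIn.mem_nhds (mem_connectedComponentIn hx)] with w hw hwy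
  apply hxy
  rw [connectedComponentIn_eq hwy, ← connectedComponentIn_eq hw]
  exact mem_connectedComponentIn hx

/-- The Korn inequality, applied to a rotation about `z` supported in a component `T` of
`Ω \ ∂B(z, r)` that misses `Q`, shows that `T` has little volume away from `z`. -/
theorem KornInequality.exists_volume_tail_le (hn : 2 ≤ n)
    {Ω Q : Set (EuclideanSpace ℝ (Fin n))} {p : ℝ≥0∞} (hp : 1 < p) (hp' : p < ⊤)
    (hΩ : IsOpen Ω) (hΩb : Bornology.IsBounded Ω) (hKorn : KornInequality Ω Q p) :
    ∃ K : ℝ, 0 ≤ K ∧ ∀ (z : EuclideanSpace ℝ (Fin n)) (r : ℝ), 0 < r →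
      ∀ y, Disjoint (connectedComponentIn (Ω \ Metric.sphere z r) y) Q →
      volume (connectedComponentIn (Ω \ Metric.sphere z r) y \ Metric.closedBall z (2 * r))
        ≤ ENNReal.ofReal (K * r ^ n) := by
  obtain ⟨C, hC⟩ := hKorn
  obtain ⟨M, hM0, hM⟩ := exists_bound_deriv_smoothTransition
  obtain ⟨A, hA, a, b, hab⟩ := exists_skew hn
  have hp0 : p ≠ 0 := (zero_lt_one.trans hp).ne'
  have hpR : 0 < p.toReal := ENNReal.toReal_pos hp0 hp'.ne
  have : Nontrivial (EuclideanSpace ℝ (Fin n)) := by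
    have : Nontrivial (Fin n) := Fin.nontrivial_iff_two_le.2 hn
    have : Nonempty (Fin n) := ⟨⟨0, by omega⟩⟩
    infer_instance
  set c : ℝ := 8 * M * ‖A‖
  have hc0 : 0 ≤ c := by positivity
  set V : ℝ := (volume (Metric.ball (0 : EuclideanSpace ℝ (Fin n)) 1)).toReal
  have hV : volume (Metric.ball (0 : EuclideanSpace ℝ (Fin n)) 1) = ENNReal.ofReal V :=
    (ENNReal.ofReal_toReal measure_ball_lt_top.ne).symm
  refine ⟨(C * c) ^ p.toReal * (2 ^ n * V), by positivity, ?_⟩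
  intro z r hr y hTQ
  set T := connectedComponentIn (Ω \ Metric.sphere z r) y with hTdef
  have hF : IsOpen (Ω \ Metric.sphere z r) := hΩ.sdiff Metric.isClosed_sphere
  have hT : IsOpen T := hF.connectedComponentIn
  have hTΩ : T ⊆ Ω := (connectedComponentIn_subset _ _).trans sdiff_subset
  set w := cutoffMotion A z r
  have hloc : ∀ x ∈ Ω, x ∉ T → ∀ᶠ u in 𝓝 x, u ∈ T → w u = 0 := by
    intro x hx hxT
    by_cases hxs : x ∈ Metric.sphere z r
    · filter_upwards [cutoffMotion_eventually_eq_zero (A := A) hr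
        (by simpa [dist_eq_norm] using hxs)] with u hu _ using hu
    · filter_upwards [eventually_notMem_connectedComponentIn hF ⟨hx, hxs⟩ hxT] with u hu hu'
      exact absurd hu' hu
  have hsob := isSobolevField_indicator (p := p) hΩ hΩb hT contDiff_cutoffMotion hloc
  have hineq := hC _ _ hsob
  set D := T.indicator fun x i j => fderiv ℝ w x (EuclideanSpace.single j 1) i with hD
  have hDQ : eLpNorm D p (volume.restrict Q) = 0 := by
    have : D =ᵐ[volume.restrict Q] 0 := by
      have h0 : volume.restrict Q T = 0 := by
        rw [Measure.restrict_apply hT.measurableSet, disjoint_iff_inter_eq_empty.1 hTQ]; simp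
      filter_upwards [measure_eq_zero_iff_ae_notMem.1 h0] with x hx
      simp [hD, hx]
    rw [eLpNorm_congr_ae this]; simp
  have hsymm : eLpNorm (fun x => symmPart (D x)) p (volume.restrict Ω)
      ≤ ENNReal.ofReal c * volume (Metric.closedBall z (2 * r)) ^ (1 / p.toReal) := by
    calc eLpNorm (fun x => symmPart (D x)) p (volume.restrict Ω)
        ≤ eLpNorm (fun x => symmPart (D x)) p volume :=
          eLpNorm_mono_measure _ Measure.restrict_le_self
      _ ≤ eLpNorm ((Metric.closedBall z (2 * r)).indicator fun _ => c) p volume := by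
          refine eLpNorm_mono_real fun x => ?_
          have hpos : 0 ≤ (Metric.closedBall z (2 * r)).indicator (fun _ => c) x :=
            indicator_nonneg (fun _ _ => hc0) _
          rw [pi_norm_le_iff_of_nonneg hpos]
          intro i
          rw [pi_norm_le_iff_of_nonneg hpos]
          intro j
          by_cases hx : x ∈ T
          · simp only [symmPart, hD, indicator_of_mem hx]
            exact abs_symm_fderiv_cutoffMotion_le hM hr hA i j
          · simp only [symmPart, hD, indicator_of_notMem hx]
            simpa using hpos
      _ = _ := by
          rw [eLpNorm_indicator_const measurableSet_closedBall hp0 hp'.ne,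
            Real.enorm_of_nonneg hc0]
  have hlow : volume (T \ Metric.closedBall z (2 * r)) ^ (1 / p.toReal)
      ≤ eLpNorm D p (volume.restrict Ω) := by
    have hmeas : MeasurableSet (T \ Metric.closedBall z (2 * r)) :=
      hT.measurableSet.diff measurableSet_closedBall
    have h1 := eLpNorm_indicator_const (μ := volume.restrict Ω) (c := (1 : ℝ)) hmeas hp0 hp'.ne
    rw [Measure.restrict_apply hmeas, inter_eq_left.2 (sdiff_subset.trans hTΩ)] at h1
    simp only [enorm_one, one_mul] at h1
    rw [← h1]
    refine eLpNorm_mono fun x => ?_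
    by_cases hx : x ∈ T \ Metric.closedBall z (2 * r)
    · rw [indicator_of_mem hx]
      have h2 : D x a b = 1 := by
        simp only [hD, indicator_of_mem hx.1, w]
        rw [fderiv_cutoffMotion_of_notMem hr hx.2, hab]
      rw [← h2]
      exact (norm_le_pi_norm (D x a) b).trans (norm_le_pi_norm (D x) a)
    · rw [indicator_of_notMem hx]; simp
  rw [hDQ, add_zero] at hineq
  have hfin := hlow.trans (hineq.trans (mul_le_mul_right hsymm _))
  have hfin2 := ENNReal.rpow_le_rpow hfin hpR.le
  rw [← ENNReal.rpow_mul, one_div_mul_cancel hpR.ne', ENNReal.rpow_one, ← mul_assoc,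
    ENNReal.mul_rpow_of_nonneg _ _ hpR.le, ← ENNReal.rpow_mul, one_div_mul_cancel hpR.ne',
    ENNReal.rpow_one, Measure.addHaar_closedBall _ _ (by positivity), hV] at hfin2
  refine hfin2.trans (le_of_eq ?_)
  rw [← ENNReal.ofReal_coe_nnreal, ← ENNReal.ofReal_mul (by positivity),
    ENNReal.ofReal_rpow_of_nonneg (by positivity) hpR.le, ← ENNReal.ofReal_mul (by positivity),
    ← ENNReal.ofReal_mul (by positivity)]
  congr 1
  simp [mul_pow]
  ring

end TestField

/-! ### Chains along a curve -/

/-- The last time `t` at which a curve `f`, starting at the time `a`, is within `ρ` of `f a`. -/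
theorem exists_last_exit {E : Type*} [PseudoMetricSpace E] {f : ℝ → E} {a b ρ : ℝ} (hab : a ≤ b)
    (hf : ContinuousOn f (Icc a b)) (hρ : 0 ≤ ρ) (hb : ρ < dist (f b) (f a)) :
    ∃ t ∈ Icc a b, dist (f t) (f a) = ρ ∧ ∀ τ ∈ Icc t b, ρ ≤ dist (f τ) (f a) := by
  have hd : ContinuousOn (fun τ => dist (f τ) (f a)) (Icc a b) := by
    fun_prop
  have hcpt : IsCompact (Icc a b ∩ (fun τ => dist (f τ) (f a)) ⁻¹' Iic ρ) :=
    isCompact_Icc.of_isClosed_subset (hd.preimage_isClosed_of_isClosed isClosed_Icc isClosed_Iic)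
      inter_subset_left
  obtain ⟨t, ⟨ht, htρ⟩, hmax⟩ := hcpt.exists_isGreatest ⟨a, left_mem_Icc.2 hab, by simpa using hρ⟩
  have htρ' : dist (f t) (f a) ≤ ρ := htρ
  have hlt : ∀ τ ∈ Icc t b, τ ≠ t → ρ < dist (f τ) (f a) := by
    intro τ hτ hne
    by_contra! hle
    exact hne (le_antisymm (hmax ⟨⟨ht.1.trans hτ.1, hτ.2⟩, hle⟩) hτ.1)
  have heq : dist (f t) (f a) = ρ := by
    obtain ⟨s, hs, hsρ⟩ := intermediate_value_Icc ht.2 (hd.mono (Icc_subset_Icc_left ht.1))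
      ⟨htρ', hb.le⟩
    have hsρ' : dist (f s) (f a) = ρ := hsρ
    by_cases hst : s = t
    · rwa [← hst]
    · exact absurd hsρ' (hlt s hs hst).ne'
  refine ⟨t, ht, heq, fun τ hτ => ?_⟩
  by_cases h : τ = t
  · rw [h, heq]
  · exact (hlt τ hτ h).le

/-- A continuous curve `f` on `[a, b]` is followed by a finite chain of times `t 0 = a, …, t N`.
Each step goes to the last time at which `f` is within `r (t k)` of `f (t k)`; the chain stops
when the end point `f b` is within this distance. -/
theorem exists_chain {E : Type*} [PseudoMetricSpace E] {f : ℝ → E} {r : ℝ → ℝ} {a b m : ℝ}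
    (hab : a ≤ b) (hf : ContinuousOn f (Icc a b)) (hm : 0 < m) (hr : ∀ τ ∈ Icc a b, m ≤ r τ) :
    ∃ (N : ℕ) (t : ℕ → ℝ), t 0 = a ∧ (∀ k ≤ N, t k ∈ Icc a b) ∧
      (∀ k < N, dist (f (t (k + 1))) (f (t k)) ≤ r (t k)) ∧
      (∀ k j, k < j → j ≤ N → t k ≤ t j ∧ ∀ τ ∈ Icc (t j) b, r (t k) ≤ dist (f τ) (f (t k))) ∧
      dist (f b) (f (t N)) ≤ r (t N) := by
  obtain ⟨δ, hδ, hδf⟩ := Metric.uniformContinuousOn_iff.1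
    (isCompact_Icc.uniformContinuousOn_of_continuous hf) m hm
  -- induction on an upper bound of the number of steps, each of which takes time at least `δ`
  have key : ∀ (K : ℕ) (a' : ℝ), a' ∈ Icc a b → b - a' ≤ K * δ →
      ∃ (N : ℕ) (t : ℕ → ℝ), t 0 = a' ∧ (∀ k ≤ N, t k ∈ Icc a' b) ∧
      (∀ k < N, dist (f (t (k + 1))) (f (t k)) ≤ r (t k)) ∧
      (∀ k j, k < j → j ≤ N → t k ≤ t j ∧ ∀ τ ∈ Icc (t j) b, r (t k) ≤ dist (f τ) (f (t k))) ∧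
      dist (f b) (f (t N)) ≤ r (t N) := by
    intro K
    induction K with
    | zero =>
      intro a' ha' hle
      have hab' : b = a' := le_antisymm (by simpa using hle) ha'.2
      refine ⟨0, fun _ => a', rfl, fun k _ => ⟨le_rfl, ha'.2⟩, by simp, by omega, ?_⟩
      rw [hab', dist_self]
      exact hm.le.trans (hr a' ha')
    | succ K ih =>
      intro a' ha' hle
      by_cases hclose : dist (f b) (f a') ≤ r a'
      · exact ⟨0, fun _ => a', rfl, fun k _ => ⟨le_rfl, ha'.2⟩, by simp, by omega, hclose⟩
      · have hra : m ≤ r a' := hr a' ha'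
        obtain ⟨t₁, ht₁, hd₁, hfar⟩ := exists_last_exit ha'.2
          (hf.mono (Icc_subset_Icc_left ha'.1)) (hm.le.trans hra) (not_le.1 hclose)
        have ht₁' : t₁ ∈ Icc a b := ⟨ha'.1.trans ht₁.1, ht₁.2⟩
        have hstep : δ ≤ t₁ - a' := by
          by_contra! hlt
          have := hδf t₁ ht₁' a' ha' (by rwa [Real.dist_eq, abs_of_nonneg (by linarith [ht₁.1])])
          linarith
        obtain ⟨N, t, h0, hmem, hdist, hsep, hend⟩ := ih t₁ ht₁' (by push_cast at hle; linarith)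
        refine ⟨N + 1, fun k => Nat.casesOn k a' t, rfl, ?_, ?_, ?_, hend⟩
        · rintro (_ | k) hk
          · exact ⟨le_rfl, ha'.2⟩
          · have := hmem k (by omega)
            exact ⟨ht₁.1.trans this.1, this.2⟩
        · rintro (_ | k) hk
          · change dist (f (t 0)) (f a') ≤ r a'
            rw [h0]; exact hd₁.le
          · exact hdist k (by omega)
        · rintro (_ | k) (_ | j) hkj hj
          · omega
          · have := hmem j (by omega)
            exact ⟨ht₁.1.trans this.1, fun τ hτ => hfar τ ⟨this.1.trans hτ.1, hτ.2⟩⟩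
          · omega
          · exact hsep k j (by omega) (by omega)
  obtain ⟨K, hK⟩ := exists_nat_ge ((b - a) / δ)
  exact key K a (left_mem_Icc.2 hab) ((div_le_iff₀ hδ).1 hK)

/-! ### Geometric summation -/

/-- If the partial sums of `a j ^ n` are dominated by the next term, then so are the partial
sums of `a j`, because the partial sums of the powers grow geometrically. -/
theorem exists_sum_le_of_sum_pow_le {n : ℕ} (hn : n ≠ 0) {C : ℝ} (hC : 0 < C) :
    ∃ C' : ℝ, 0 ≤ C' ∧ ∀ (N : ℕ) (a : ℕ → ℝ), (∀ k, 0 ≤ a k) →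
      (∀ m ≤ N, ∑ j ∈ Finset.range m, a j ^ n ≤ C * a m ^ n) →
      ∀ m ≤ N, ∑ j ∈ Finset.range m, a j ≤ C' * a m := by
  have hn' : (n : ℝ) ≠ 0 := by exact_mod_cast hn
  set θ : ℝ := C / (1 + C) with hθ
  have hθ0 : 0 ≤ θ := by positivity
  have hθ1 : θ < 1 := (div_lt_one (by positivity)).2 (by linarith)
  set q : ℝ := θ ^ (1 / (n : ℝ))
  have hq0 : 0 ≤ q := Real.rpow_nonneg hθ0 _
  have hqn : q ^ n = θ := by
    rw [← Real.rpow_natCast, ← Real.rpow_mul hθ0, one_div_mul_cancel hn', Real.rpow_one]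
  have hq1 : q < 1 := by
    by_contra! h
    have := one_le_pow₀ h (n := n)
    linarith
  set D : ℝ := C ^ (1 / (n : ℝ))
  have hD0 : 0 ≤ D := Real.rpow_nonneg hC.le _
  have hDn : D ^ n = C := by
    rw [← Real.rpow_natCast, ← Real.rpow_mul hC.le, one_div_mul_cancel hn', Real.rpow_one]
  have h1q : 0 < 1 - q := by linarith
  refine ⟨D * (1 - q)⁻¹, by positivity, ?_⟩
  intro N a ha h m hm
  set P : ℕ → ℝ := fun k => ∑ j ∈ Finset.range k, a j ^ n with hP
  have hPsucc : ∀ k, P (k + 1) = P k + a k ^ n := fun k => Finset.sum_range_succ _ _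
  have hPle : ∀ k ≤ N, P k ≤ θ * P (k + 1) := by
    intro k hk
    have h1 : P k ≤ C * a k ^ n := h k hk
    have h2 : C * P (k + 1) / (1 + C) = θ * P (k + 1) := by rw [hθ]; ring
    rw [← h2, le_div_iff₀ (by positivity), hPsucc]
    linarith
  have hdecay : ∀ i, i ≤ m → P (m - i) ≤ θ ^ i * P m := by
    intro i
    induction i with
    | zero => simp
    | succ i ih =>
      intro hi
      have h1 := hPle (m - (i + 1)) (by omega)
      rw [show m - (i + 1) + 1 = m - i by omega] at h1
      calc _ ≤ θ * P (m - i) := h1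
        _ ≤ θ * (θ ^ i * P m) := mul_le_mul_of_nonneg_left (ih (by omega)) hθ0
        _ = _ := by ring
  have hterm : ∀ i < m, a (m - 1 - i) ≤ q ^ i * (D * a m) := by
    intro i hi
    refine le_of_pow_le_pow_left₀ hn (by have := ha m; positivity) ?_
    calc a (m - 1 - i) ^ n ≤ P (m - i) := by
          rw [show m - i = m - 1 - i + 1 by omega, hPsucc]
          have : 0 ≤ P (m - 1 - i) := Finset.sum_nonneg fun j _ => pow_nonneg (ha j) n
          linarith
      _ ≤ θ ^ i * P m := hdecay i hi.le
      _ ≤ θ ^ i * (C * a m ^ n) := mul_le_mul_of_nonneg_left (h m hm) (by positivity)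
      _ = (q ^ i * (D * a m)) ^ n := by
          rw [mul_pow, mul_pow, hDn, ← pow_mul, mul_comm i n, pow_mul, hqn]
  rw [← Finset.sum_range_reflect]
  calc _ ≤ ∑ i ∈ Finset.range m, q ^ i * (D * a m) :=
        Finset.sum_le_sum fun i hi => hterm i (Finset.mem_range.1 hi)
    _ = (∑ i ∈ Finset.range m, q ^ i) * (D * a m) := by rw [Finset.sum_mul]
    _ ≤ (1 - q)⁻¹ * (D * a m) := by
        refine mul_le_mul_of_nonneg_right ?_ (mul_nonneg hD0 (ha m))
        rw [← tsum_geometric_of_lt_one hq0 hq1]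
        exact (summable_geometric_of_lt_one hq0 hq1).sum_le_tsum _ fun i _ => pow_nonneg hq0 i
    _ = _ := by ring

/-! ### The distance to the boundary -/

section BdryDist

variable {n : ℕ} {Ω : Set (EuclideanSpace ℝ (Fin n))} {x y : EuclideanSpace ℝ (Fin n)}

theorem bdryDist_le_add_dist : bdryDist Ω x ≤ bdryDist Ω y + dist x y :=
  Metric.infDist_le_infDist_add_dist

theorem bdryDist_nonneg : 0 ≤ bdryDist Ω x := Metric.infDist_nonneg

theorem continuous_bdryDist : Continuous (bdryDist Ω) := Metric.continuous_infDist_pt _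

theorem bdryDist_pos (hΩ : IsOpen Ω) (hfr : (frontier Ω).Nonempty) (hx : x ∈ Ω) :
    0 < bdryDist Ω x := by
  refine (isClosed_frontier.notMem_iff_infDist_pos hfr).1 fun h => ?_
  rw [hΩ.frontier_eq] at h
  exact h.2 hx

/-- The distance to the boundary is the distance to the complement: the ball is connected and does
not meet the frontier of `Ω`. -/
theorem ball_bdryDist_subset (hΩ : IsOpen Ω) (hx : x ∈ Ω) :
    Metric.ball x (bdryDist Ω x) ⊆ Ω := by
  by_cases hr : 0 < bdryDist Ω x
  · have hdisj : Disjoint (Metric.ball x (bdryDist Ω x)) (frontier Ω) := Metric.disjoint_ball_infDist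
    have hconn : IsPreconnected (Metric.ball x (bdryDist Ω x)) := (convex_ball _ _).isPreconnected
    refine (hconn.subset_or_subset hΩ isClosed_closure.isOpen_compl
      (disjoint_compl_right.mono_left subset_closure) ?_).resolve_right ?_
    · intro y hy
      by_cases hyc : y ∈ closure Ω
      · left
        by_contra hyΩ
        exact disjoint_left.1 hdisj hy (by rw [hΩ.frontier_eq]; exact ⟨hyc, hyΩ⟩)
      · exact Or.inr hyc
    · intro h
      exact h (Metric.mem_ball_self hr) (subset_closure hx)
  · rw [Metric.ball_eq_empty.2 (not_lt.1 hr)]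
    exact empty_subset _

theorem frontier_nonempty_of_isBounded (hn : 2 ≤ n) (hΩ : Bornology.IsBounded Ω)
    (hne : Ω.Nonempty) : (frontier Ω).Nonempty := by
  have : Nonempty (Fin n) := ⟨⟨0, by omega⟩⟩
  have : NoncompactSpace (EuclideanSpace ℝ (Fin n)) := NormedSpace.noncompactSpace ℝ _
  refine nonempty_frontier_iff.2 ⟨hne, ?_⟩
  rintro rfl
  exact NormedSpace.unbounded_univ ℝ _ hΩ

theorem exists_pos_le_bdryDist (hΩ : IsOpen Ω) (hfr : (frontier Ω).Nonempty)
    {K : Set (EuclideanSpace ℝ (Fin n))} (hK : IsCompact K) (hKΩ : K ⊆ Ω) :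
    ∃ m > 0, ∀ x ∈ K, m ≤ bdryDist Ω x := by
  rcases K.eq_empty_or_nonempty with rfl | hne
  · exact ⟨1, one_pos, by simp⟩
  · obtain ⟨x, hx, hmin⟩ := hK.exists_isMinOn hne continuous_bdryDist.continuousOn
    exact ⟨bdryDist Ω x, bdryDist_pos hΩ hfr (hKΩ hx), fun y hy => hmin hy⟩

end BdryDist

/-! ### Korn and separation: control of the diameter of the curves -/

section Packing

variable {n : ℕ}

/-- Packing bound: disjoint balls in a set of volume at most `B` have `∑ ρᵢⁿ ≤ B / |B(0, 1)|`. -/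
theorem sum_pow_le_of_disjoint_balls {ι : Type*} {s : Finset ι}
    {z : ι → EuclideanSpace ℝ (Fin n)} {ρ : ι → ℝ} {S : Set (EuclideanSpace ℝ (Fin n))} {B : ℝ}
    (hρ : ∀ i ∈ s, 0 < ρ i) (hsep : ∀ i ∈ s, ∀ j ∈ s, i ≠ j → ρ i + ρ j ≤ dist (z i) (z j))
    (hS : ∀ i ∈ s, Metric.ball (z i) (ρ i) ⊆ S) (hB : 0 ≤ B) (hvol : volume S ≤ ENNReal.ofReal B) :
    ∑ i ∈ s, ρ i ^ n ≤ B / (volume (Metric.ball (0 : EuclideanSpace ℝ (Fin n)) 1)).toReal := by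
  set V : ℝ := (volume (Metric.ball (0 : EuclideanSpace ℝ (Fin n)) 1)).toReal
  have hV : volume (Metric.ball (0 : EuclideanSpace ℝ (Fin n)) 1) = ENNReal.ofReal V :=
    (ENNReal.ofReal_toReal measure_ball_lt_top.ne).symm
  have hV0 : 0 < V :=
    ENNReal.toReal_pos (Metric.measure_ball_pos _ _ one_pos).ne' measure_ball_lt_top.ne
  rw [le_div_iff₀ hV0, ← ENNReal.ofReal_le_ofReal_iff hB]
  refine le_trans (le_of_eq ?_) ((measure_mono (iUnion₂_subset hS)).trans hvol)
  rw [measure_biUnion_finset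
    (fun i hi j hj hij => Metric.ball_disjoint_ball (hsep i hi j hj hij))
    (fun _ _ => measurableSet_ball), Finset.sum_mul, ENNReal.ofReal_sum_of_nonneg]
  · refine Finset.sum_congr rfl fun i hi => ?_
    rw [Measure.addHaar_ball_of_pos _ _ (hρ i hi), hV,
      ENNReal.ofReal_mul (pow_nonneg (hρ i hi).le n)]
    simp
  · exact fun i hi => mul_nonneg (pow_nonneg (hρ i hi).le n) hV0.le

end Packing

section Carrot

variable {n : ℕ} {Ω Q : Set (EuclideanSpace ℝ (Fin n))} {x₀ : EuclideanSpace ℝ (Fin n)}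

theorem IsClosedCube.isConnected (hQ : IsClosedCube Q) : IsConnected Q := by
  obtain ⟨e, s, hs, rfl⟩ := hQ
  have hconv : Convex ℝ {x : EuclideanSpace ℝ (Fin n) | ∀ i, |x i| ≤ s} := by
    intro x hx y hy a b ha hb hab i
    have h1 := abs_le.1 (hx i)
    have h2 := abs_le.1 (hy i)
    have h3 : (a • x + b • y) i = a * x i + b * y i := by simp
    rw [h3, abs_le]
    constructor <;> nlinarith
  exact ⟨⟨e 0, mem_image_of_mem e (by simp [hs.le])⟩,
    hconv.isPreconnected.image e e.continuous.continuousOn⟩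

theorem IsClosedCube.isClosed (hQ : IsClosedCube Q) : IsClosed Q := by
  obtain ⟨e, s, -, rfl⟩ := hQ
  refine e.toHomeomorph.isClosedMap _ ?_
  simp only [ofPred_forall]
  exact isClosed_iInter fun i => isClosed_le (by fun_prop) continuous_const

/-- If `z` is close to the boundary, then a component of `Ω \ ∂B(z, C ρ(z))` that does not contain
`x₀` misses `Q`: the two are joined by a compact connected subset of `Ω`, which such a small
sphere does not meet. -/
theorem exists_disjoint_connectedComponentIn (hΩ : IsOpen Ω) (hΩc : IsConnected Ω)
    (hΩb : Bornology.IsBounded Ω) (hfr : (frontier Ω).Nonempty) (hQ : IsClosedCube Q)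
    (hQΩ : Q ⊆ Ω) (hx₀ : x₀ ∈ Ω) {C : ℝ} (hC : 1 ≤ C) :
    ∃ d > 0, ∀ z, bdryDist Ω z < d → ∀ y,
      x₀ ∉ connectedComponentIn (Ω \ Metric.sphere z (C * bdryDist Ω z)) y →
      Disjoint (connectedComponentIn (Ω \ Metric.sphere z (C * bdryDist Ω z)) y) Q := by
  obtain ⟨q₀, hq₀⟩ := hQ.isConnected.nonempty
  have hpath := hΩ.isConnected_iff_isPathConnected.1 hΩc
  obtain ⟨P, hP⟩ := hpath.joinedIn q₀ (hQΩ hq₀) x₀ hx₀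
  have hPc : IsCompact (range P) := isCompact_range P.continuous
  have hQc : IsCompact Q := Metric.isCompact_of_isClosed_isBounded hQ.isClosed (hΩb.subset hQΩ)
  obtain ⟨m, hm, hmK⟩ := exists_pos_le_bdryDist hΩ hfr (hQc.union hPc)
    (union_subset hQΩ (range_subset_iff.2 hP))
  have hKconn : IsPreconnected (Q ∪ range P) :=
    IsPreconnected.union q₀ hq₀ ⟨0, P.source⟩ hQ.isConnected.isPreconnected
      (isPreconnected_range P.continuous)
  refine ⟨m / (1 + C), by positivity, fun z hz y hy => ?_⟩
  rw [lt_div_iff₀ (by positivity)] at hz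
  have hsub : Q ∪ range P ⊆ Ω \ Metric.sphere z (C * bdryDist Ω z) := by
    intro q hq
    refine ⟨union_subset hQΩ (range_subset_iff.2 hP) hq, fun hqs => ?_⟩
    have h1 := hmK q hq
    have h2 : bdryDist Ω q ≤ bdryDist Ω z + dist q z := bdryDist_le_add_dist
    rw [Metric.mem_sphere.1 hqs] at h2
    linarith
  rw [disjoint_left]
  intro q hqT hqQ
  apply hy
  rw [connectedComponentIn_eq hqT]
  exact hKconn.subset_connectedComponentIn (Or.inl hqQ) hsub (Or.inr ⟨1, P.target⟩)

/-- The volume bound of `KornInequality.exists_volume_tail_le` at the scale `C ρ(z)` holds for every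
component that does not contain `x₀`; for `z` far from the boundary it is trivial. -/
theorem exists_volume_component_le (hn : 2 ≤ n) {p : ℝ≥0∞} (hp : 1 < p) (hp' : p < ⊤)
    (hΩ : IsOpen Ω) (hΩc : IsConnected Ω) (hΩb : Bornology.IsBounded Ω) (hQ : IsClosedCube Q)
    (hQΩ : Q ⊆ Ω) (hKorn : KornInequality Ω Q p) (hx₀ : x₀ ∈ Ω) {C : ℝ} (hC : 1 ≤ C) :
    ∃ K : ℝ, 0 ≤ K ∧ ∀ z ∈ Ω, ∀ y,
      x₀ ∉ connectedComponentIn (Ω \ Metric.sphere z (C * bdryDist Ω z)) y →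
      volume (connectedComponentIn (Ω \ Metric.sphere z (C * bdryDist Ω z)) y \
        Metric.closedBall z (2 * (C * bdryDist Ω z))) ≤ ENNReal.ofReal (K * bdryDist Ω z ^ n) := by
  have hfr := frontier_nonempty_of_isBounded hn hΩb hΩc.nonempty
  obtain ⟨d, hd, hdisj⟩ := exists_disjoint_connectedComponentIn hΩ hΩc hΩb hfr hQ hQΩ hx₀ hC
  obtain ⟨K, hK0, hK⟩ := hKorn.exists_volume_tail_le hn hp hp' hΩ hΩb
  set W : ℝ := (volume Ω).toReal
  have hW : volume Ω = ENNReal.ofReal W := (ENNReal.ofReal_toReal hΩb.measure_lt_top.ne).symm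
  have hW0 : 0 ≤ W := ENNReal.toReal_nonneg
  refine ⟨K * C ^ n + W / d ^ n, by positivity, fun z hz y hy => ?_⟩
  have hρ := bdryDist_pos hΩ hfr hz
  rcases lt_or_ge (bdryDist Ω z) d with hzd | hzd
  · refine (hK z (C * bdryDist Ω z) (by positivity) y (hdisj z hzd y hy)).trans
      (ENNReal.ofReal_le_ofReal ?_)
    have : 0 ≤ W / d ^ n * bdryDist Ω z ^ n := by positivity
    rw [mul_pow, add_mul]
    linarith
  · refine (measure_mono (sdiff_subset.trans
      ((connectedComponentIn_subset _ _).trans sdiff_subset))).trans ?_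
    rw [hW]
    refine ENNReal.ofReal_le_ofReal ?_
    have h1 : d ^ n ≤ bdryDist Ω z ^ n := pow_le_pow_left₀ hd.le hzd n
    have h2 : W ≤ W / d ^ n * bdryDist Ω z ^ n := by
      rw [div_mul_eq_mul_div, le_div_iff₀ (by positivity)]
      exact mul_le_mul_of_nonneg_left h1 hW0
    have h3 : 0 ≤ K * C ^ n * bdryDist Ω z ^ n := by positivity
    rw [add_mul]
    linarith

/-- If a curve `γ` satisfies the separation condition, then the part of `γ`
before the time `t` stays within a multiple of `ρ(γ(t))` of `γ(t)`. -/
theorem exists_dist_le_bdryDist_of_separation (hn : 2 ≤ n) (hΩ : IsOpen Ω)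
    (hfr : (frontier Ω).Nonempty) {C K : ℝ} (hC : 1 ≤ C) (hK0 : 0 ≤ K)
    (hK : ∀ z ∈ Ω, ∀ y,
      x₀ ∉ connectedComponentIn (Ω \ Metric.sphere z (C * bdryDist Ω z)) y →
      volume (connectedComponentIn (Ω \ Metric.sphere z (C * bdryDist Ω z)) y \
        Metric.closedBall z (2 * (C * bdryDist Ω z))) ≤
          ENNReal.ofReal (K * bdryDist Ω z ^ n)) :
    ∃ M : ℝ, 0 ≤ M ∧ ∀ γ : ℝ → EuclideanSpace ℝ (Fin n),
      ContinuousOn γ (Icc 0 1) → MapsTo γ (Icc 0 1) Ω →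
      (∀ t ∈ Icc (0 : ℝ) 1,
        γ '' Icc 0 t ⊆ Metric.closedBall (γ t) (C * bdryDist Ω (γ t)) ∨
        ∀ y ∈ γ '' Icc 0 t \ Metric.closedBall (γ t) (C * bdryDist Ω (γ t)),
          x₀ ∉ connectedComponentIn (Ω \ Metric.sphere (γ t) (C * bdryDist Ω (γ t))) y) →
      ∀ s t, 0 ≤ s → s ≤ t → t ≤ 1 → dist (γ s) (γ t) ≤ M * bdryDist Ω (γ t) := by
  set V : ℝ := (volume (Metric.ball (0 : EuclideanSpace ℝ (Fin n)) 1)).toReal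
  have hV0 : 0 < V :=
    ENNReal.toReal_pos (Metric.measure_ball_pos _ _ one_pos).ne' measure_ball_lt_top.ne
  obtain ⟨C', hC'0, hC'⟩ := exists_sum_le_of_sum_pow_le (n := n) (by omega)
    (C := 4 ^ n * (K / V) + 1) (by positivity)
  refine ⟨4 * C * (C' + 1), by positivity, ?_⟩
  intro γ hγ hγΩ hγsep s t hs hst ht
  -- run the curve backwards from the time `t` to the time `s`
  set f : ℝ → EuclideanSpace ℝ (Fin n) := fun τ => γ (-τ) with hf
  have hmaps : ∀ τ ∈ Icc (-t) (-s), -τ ∈ Icc (0 : ℝ) 1 := fun τ hτ =>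
    ⟨by linarith [hτ.2], by linarith [hτ.1]⟩
  have hfc : ContinuousOn f (Icc (-t) (-s)) := hγ.comp continuous_neg.continuousOn hmaps
  have hfΩ : ∀ τ ∈ Icc (-t) (-s), f τ ∈ Ω := fun τ hτ => hγΩ (hmaps τ hτ)
  obtain ⟨m, hm, hmle⟩ := exists_pos_le_bdryDist hΩ hfr (isCompact_Icc.image_of_continuousOn hfc)
    (image_subset_iff.2 hfΩ)
  -- the factor `4` leaves room for balls of radius `ρ(z_j) / 4` outside the ball of radius
  -- `2 C ρ(z_k)` in which the rotation is cut off
  obtain ⟨N, u, hu0, humem, hudist, husep, huend⟩ := exists_chain (f := f)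
    (r := fun τ => 4 * C * bdryDist Ω (f τ)) (m := 4 * C * m) (neg_le_neg hst) hfc (by positivity)
    (fun τ hτ => mul_le_mul_of_nonneg_left (hmle _ (mem_image_of_mem f hτ)) (by positivity))
  set z : ℕ → EuclideanSpace ℝ (Fin n) := fun k => f (u k) with hz
  set g : ℕ → ℝ := fun k => bdryDist Ω (z k) with hg
  have hzΩ : ∀ k ≤ N, z k ∈ Ω := fun k hk => hfΩ _ (humem k hk)
  have hg0 : ∀ k ≤ N, 0 < g k := fun k hk => bdryDist_pos hΩ hfr (hzΩ k hk)
  have hfar : ∀ k j, k < j → j ≤ N → 4 * C * g k ≤ dist (z j) (z k) := fun k j hkj hj =>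
    (husep k j hkj hj).2 (u j) ⟨le_rfl, (humem j hj).2⟩
  have hfar1 : ∀ k j, k < j → j ≤ N → 4 * g k ≤ dist (z j) (z k) ∧
      4 * g j ≤ 5 * dist (z j) (z k) := by
    intro k j hkj hj
    have h1 := hfar k j hkj hj
    have h2 : g j ≤ g k + dist (z j) (z k) := bdryDist_le_add_dist
    have h3 := hg0 k (by omega)
    have h4 : 4 * g k ≤ 4 * C * g k := by nlinarith
    exact ⟨by linarith, by linarith⟩
  -- the later balls lie in the component of the end point, away from the `k`-th ball
  have hball : ∀ k j, k < j → j ≤ N → Metric.ball (z j) (g j / 4) ⊆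
      connectedComponentIn (Ω \ Metric.sphere (z k) (C * g k)) (f (-s)) \
        Metric.closedBall (z k) (2 * (C * g k)) := by
    intro k j hkj hj
    have hgk := hg0 k (by omega)
    have hgj := hg0 j hj
    have hCg : 0 < C * g k := by positivity
    have hfarball : ∀ w ∈ Metric.ball (z j) (g j / 4), 2 * (C * g k) < dist w (z k) := by
      intro w hw
      have h1 := hfar k j hkj hj
      have h2 := (hfar1 k j hkj hj).2
      have h3 : dist (z j) (z k) ≤ dist w (z j) + dist w (z k) := dist_triangle_left _ _ _
      have h4 : dist w (z j) < g j / 4 := hw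
      linarith
    have hcurve : f '' Icc (u j) (-s) ⊆ Ω \ Metric.sphere (z k) (C * g k) := by
      rintro _ ⟨τ, hτ, rfl⟩
      refine ⟨hfΩ τ ⟨(humem j hj).1.trans hτ.1, hτ.2⟩, fun h => ?_⟩
      have h1 : 4 * C * g k ≤ dist (f τ) (z k) := (husep k j hkj hj).2 τ hτ
      rw [Metric.mem_sphere.1 h] at h1
      linarith
    have hcconn : IsPreconnected (f '' Icc (u j) (-s)) :=
      isPreconnected_Icc.image f (hfc.mono (Icc_subset_Icc_left (humem j hj).1))
    have hzj : z j ∈ connectedComponentIn (Ω \ Metric.sphere (z k) (C * g k)) (f (-s)) :=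
      hcconn.subset_connectedComponentIn
        (mem_image_of_mem f (right_mem_Icc.2 (humem j hj).2)) hcurve
        (mem_image_of_mem f (left_mem_Icc.2 (humem j hj).2))
    intro w hw
    refine ⟨?_, fun h => (hfarball w hw).not_ge h⟩
    rw [connectedComponentIn_eq hzj]
    refine (convex_ball (z j) (g j / 4)).isPreconnected.subset_connectedComponentIn
      (Metric.mem_ball_self (by positivity)) ?_ hw
    intro v hv
    refine ⟨ball_bdryDist_subset hΩ (hzΩ j hj) (Metric.ball_subset_ball (by linarith) hv),
      fun h => ?_⟩
    have h1 := hfarball v hv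
    rw [Metric.mem_sphere.1 h] at h1
    linarith
  have hvol : ∀ k < N, volume (connectedComponentIn (Ω \ Metric.sphere (z k) (C * g k)) (f (-s)) \
        Metric.closedBall (z k) (2 * (C * g k))) ≤ ENNReal.ofReal (K * g k ^ n) := by
    intro k hk
    refine hK (z k) (hzΩ k hk.le) _ ?_
    have hmem := humem k hk.le
    have hend : 4 * C * g k ≤ dist (f (-s)) (z k) :=
      (husep k (k + 1) (by omega) hk).2 (-s) ⟨(humem (k + 1) hk).2, le_rfl⟩
    have hCg : 0 < C * g k := mul_pos (by linarith) (hg0 k hk.le)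
    have hnot : f (-s) ∉ Metric.closedBall (z k) (C * g k) := fun h => by
      have h1 := Metric.mem_closedBall.1 h
      linarith
    have him : f (-s) ∈ γ '' Icc 0 (-u k) := by
      refine ⟨s, ⟨hs, by linarith [hmem.2]⟩, by simp [hf]⟩
    rcases hγsep (-u k) (hmaps _ hmem) with h | h
    · exact absurd (h him) hnot
    · exact h _ ⟨him, hnot⟩
  -- the chain is counted from its end, since the sums run over the later balls
  have hsums : ∀ m ≤ N, ∑ i ∈ Finset.range m, |g (N - i)| ^ n
      ≤ (4 ^ n * (K / V) + 1) * |g (N - m)| ^ n := by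
    intro m hm
    rcases Nat.eq_zero_or_pos m with rfl | hm0
    · simp only [Finset.range_zero, Finset.sum_empty]
      positivity
    have hpack := sum_pow_le_of_disjoint_balls (s := Finset.range m) (z := fun i => z (N - i))
      (ρ := fun i => g (N - i) / 4) (B := K * g (N - m) ^ n)
      (S := connectedComponentIn (Ω \ Metric.sphere (z (N - m)) (C * g (N - m))) (f (-s)) \
        Metric.closedBall (z (N - m)) (2 * (C * g (N - m))))
      (fun i _ => by have := hg0 (N - i) (by omega); positivity) ?_
      (fun i hi => hball _ _ (by have := Finset.mem_range.1 hi; omega) (by omega))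
      (by have := hg0 (N - m) (by omega); positivity) (hvol _ (by omega))
    · have hge := hg0 (N - m) (by omega)
      rw [abs_of_pos hge]
      have heq : ∑ i ∈ Finset.range m, |g (N - i)| ^ n
          = 4 ^ n * ∑ i ∈ Finset.range m, (g (N - i) / 4) ^ n := by
        rw [Finset.mul_sum]
        refine Finset.sum_congr rfl fun i _ => ?_
        rw [abs_of_pos (hg0 (N - i) (by omega)), div_pow]
        field_simp
      rw [heq]
      calc _ ≤ 4 ^ n * (K * g (N - m) ^ n / V) := mul_le_mul_of_nonneg_left hpack (by positivity)
        _ ≤ 4 ^ n * (K * g (N - m) ^ n / V) + g (N - m) ^ n := by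
            have := pow_pos hge n; linarith
        _ = _ := by ring
    · intro i hi j hj hij
      have hi' := Finset.mem_range.1 hi
      have hj' := Finset.mem_range.1 hj
      rcases lt_or_gt_of_ne hij with h | h
      · have := hfar1 (N - j) (N - i) (by omega) (by omega)
        linarith [dist_nonneg (x := z (N - i)) (y := z (N - j))]
      · have := hfar1 (N - i) (N - j) (by omega) (by omega)
        rw [dist_comm] at this
        linarith [dist_nonneg (x := z (N - i)) (y := z (N - j))]
  have hfinal := hC' N (fun i => |g (N - i)|) (fun _ => abs_nonneg _) hsums N le_rfl
  have hpath : dist (z 0) (z N) ≤ ∑ k ∈ Finset.range N, 4 * C * g k := by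
    refine (dist_le_range_sum_dist z N).trans (Finset.sum_le_sum fun k hk => ?_)
    rw [dist_comm]
    exact hudist k (Finset.mem_range.1 hk)
  have hall : ∑ k ∈ Finset.range (N + 1), g k ≤ (C' + 1) * g 0 := by
    rw [← Finset.sum_range_reflect, Finset.sum_range_succ]
    have h0 := hg0 0 (by omega)
    simp only [Nat.sub_self, abs_of_pos h0, Nat.add_sub_cancel] at hfinal ⊢
    have : ∑ i ∈ Finset.range N, g (N - i) ≤ ∑ i ∈ Finset.range N, |g (N - i)| :=
      Finset.sum_le_sum fun i _ => le_abs_self _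
    linarith
  have hz0 : z 0 = γ t := by simp [hz, hf, hu0]
  have hend : dist (γ s) (z N) ≤ 4 * C * g N := by simpa [hf] using huend
  have hgt : g 0 = bdryDist Ω (γ t) := by simp only [hg, hz0]
  calc dist (γ s) (γ t) ≤ dist (γ s) (z N) + dist (z N) (γ t) := dist_triangle _ _ _
    _ ≤ 4 * C * g N + ∑ k ∈ Finset.range N, 4 * C * g k := by
        rw [← hz0, dist_comm (z N)]; exact add_le_add hend hpath
    _ = 4 * C * ∑ k ∈ Finset.range (N + 1), g k := by
        rw [Finset.sum_range_succ, ← Finset.mul_sum]; ring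
    _ ≤ 4 * C * ((C' + 1) * g 0) := mul_le_mul_of_nonneg_left hall (by positivity)
    _ = _ := by rw [hgt]; ring

end Carrot

/-! ### From diameter to length -/

section Polygon

/-- An isometric map of an interval has unit speed. -/
theorem hasUnitSpeedOn_Icc_of_edist {E : Type*} [PseudoEMetricSpace E] {f : ℝ → E} {a b : ℝ}
    (h : ∀ x ∈ Icc a b, ∀ y ∈ Icc a b, edist (f x) (f y) = edist x y) :
    HasUnitSpeedOn f (Icc a b) := by
  rw [HasUnitSpeedOn, hasConstantSpeedOnWith_iff_ordered]
  intro x hx y hy hxy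
  have hid : eVariationOn (id : ℝ → ℝ) (Icc a b ∩ Icc x y) = ENNReal.ofReal (y - x) :=
    monotoneOn_id.eVariationOn_eq (s := Icc a b) hx hy
  have hlip : LipschitzOnWith 1 f (Icc a b) := fun u hu v hv => by simp [h u hu v hv]
  apply le_antisymm
  · have := hlip.comp_eVariationOn_le (g := id) (s := Icc a b ∩ Icc x y) (fun u hu => hu.1)
    simpa [hid] using this
  · refine le_trans (le_of_eq ?_) (eVariationOn.edist_le f (x := y) (y := x)
      (s := Icc a b ∩ Icc x y) ⟨hy, hxy, le_rfl⟩ ⟨hx, le_rfl, hxy⟩)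
    rw [h y hy x hx, edist_dist, Real.dist_eq, abs_of_nonneg (by linarith)]
    simp

/-- The polygonal curve with vertices `z 0, …, z N`, parametrised by arclength. Each point of the
curve at a positive time lies on the segment after some vertex `z k`. -/
theorem exists_unitSpeed_polygon {E : Type*} [NormedAddCommGroup E] [NormedSpace ℝ E]
    (z : ℕ → E) (N : ℕ) : ∃ (l : ℝ) (γ : ℝ → E), 0 ≤ l ∧ l = ∑ j ∈ Finset.range N,
        dist (z (j + 1)) (z j) ∧ HasUnitSpeedOn γ (Icc 0 l) ∧ γ 0 = z 0 ∧ γ l = z N ∧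
      ∀ t ∈ Icc 0 l, t = 0 ∨ ∃ k < N, dist (γ t) (z k) ≤ dist (z (k + 1)) (z k) ∧
        t ≤ ∑ j ∈ Finset.range (k + 1), dist (z (j + 1)) (z j) := by
  induction N with
  | zero =>
    refine ⟨0, fun _ => z 0, le_rfl, by simp, ?_, rfl, rfl, fun t ht => Or.inl ?_⟩
    · exact hasConstantSpeedOnWith_of_subsingleton _ (by simp) _
    · exact le_antisymm ht.2 ht.1
  | succ N ih =>
    obtain ⟨l, γ, hl, hlsum, hγ, h0, hend, hpos⟩ := ih
    set d := dist (z (N + 1)) (z N) with hd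
    have hd0 : 0 ≤ d := dist_nonneg
    -- if `d = 0`, then division by zero is harmless: the new segment is a point
    set γ' : ℝ → E := fun t => if t ≤ l then γ t else z N + ((t - l) / d) • (z (N + 1) - z N)
      with hγ'
    have hfirst : ∀ t ∈ Icc 0 l, γ' t = γ t := fun t ht => by simp [hγ', ht.2]
    have hsecond : ∀ t ∈ Icc l (l + d),
        γ' t = z N + ((t - l) / d) • (z (N + 1) - z N) := by
      intro t ht
      rcases eq_or_lt_of_le ht.1 with rfl | h
      · simp [hγ', hend]
      · simp [hγ', not_le.2 h]
    refine ⟨l + d, γ', by positivity, by rw [Finset.sum_range_succ, hlsum], ?_, ?_, ?_, ?_⟩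
    · have h1 : HasUnitSpeedOn γ' (Icc 0 l) := by
        intro x hx y hy
        rw [← hγ hx hy]
        exact eVariationOn.congr fun t ht => hfirst t ht.1
      refine h1.Icc_Icc (hasUnitSpeedOn_Icc_of_edist fun x hx y hy => ?_)
      rw [hsecond x hx, hsecond y hy, edist_dist, edist_dist, dist_add_left, dist_eq_norm,
        ← sub_smul, norm_smul, ← sub_div, ← dist_eq_norm (z (N + 1)), ← hd]
      congr 1
      rcases eq_or_lt_of_le hd0 with h | h
      · rw [← h, mul_zero, Real.dist_eq]
        have hxl : x = l := le_antisymm (by linarith [hx.2]) hx.1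
        have hyl : y = l := le_antisymm (by linarith [hy.2]) hy.1
        rw [hxl, hyl]; simp
      · rw [Real.norm_eq_abs, abs_div, abs_of_pos h, div_mul_cancel₀ _ h.ne', Real.dist_eq]
        congr 1
        ring
    · rw [hfirst 0 ⟨le_rfl, hl⟩, h0]
    · rw [hsecond (l + d) ⟨by linarith, le_rfl⟩]
      rcases eq_or_lt_of_le hd0 with h | h
      · have : z (N + 1) = z N := dist_eq_zero.1 (by rw [← hd, ← h])
        simp [this]
      · simp [div_self h.ne']
    · intro t ht
      rcases le_or_gt t l with h | h
      · rw [hfirst t ⟨ht.1, h⟩]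
        rcases hpos t ⟨ht.1, h⟩ with h | ⟨k, hk, hk'⟩
        · exact Or.inl h
        · exact Or.inr ⟨k, by omega, hk'⟩
      · refine Or.inr ⟨N, by omega, ?_, ?_⟩
        · rw [hsecond t ⟨h.le, ht.2⟩, dist_self_add_left, norm_smul, ← dist_eq_norm, ← hd,
            Real.norm_eq_abs, abs_of_nonneg (div_nonneg (by linarith) hd0)]
          exact mul_le_of_le_one_left hd0 (div_le_one_of_le₀ (by linarith [ht.2]) hd0)
        · rw [Finset.sum_range_succ, ← hlsum]
          exact ht.2

end Polygon

section John

variable {n : ℕ} {Ω : Set (EuclideanSpace ℝ (Fin n))} {x₀ : EuclideanSpace ℝ (Fin n)}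

/-- Carrots measured by diameter can be replaced by carrots measured by length: each curve is
replaced by a polygonal curve through a chain of balls of comparable size and disjoint cores. -/
theorem isJohn_of_dist_le_bdryDist (hn : 2 ≤ n) (hΩ : IsOpen Ω) (hfr : (frontier Ω).Nonempty)
    (hx₀ : x₀ ∈ Ω) {M : ℝ} (hM0 : 0 ≤ M)
    (hM : ∀ x ∈ Ω, ∃ γ : ℝ → EuclideanSpace ℝ (Fin n),
      ContinuousOn γ (Icc 0 1) ∧ MapsTo γ (Icc 0 1) Ω ∧ γ 0 = x ∧ γ 1 = x₀ ∧
      ∀ s t, 0 ≤ s → s ≤ t → t ≤ 1 → dist (γ s) (γ t) ≤ M * bdryDist Ω (γ t)) :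
    IsJohn Ω x₀ := by
  have : Nontrivial (EuclideanSpace ℝ (Fin n)) := by
    have : Nontrivial (Fin n) := Fin.nontrivial_iff_two_le.2 hn
    have : Nonempty (Fin n) := ⟨⟨0, by omega⟩⟩
    infer_instance
  set V : ℝ := (volume (Metric.ball (0 : EuclideanSpace ℝ (Fin n)) 1)).toReal
  have hV0 : 0 < V :=
    ENNReal.toReal_pos (Metric.measure_ball_pos _ _ one_pos).ne' measure_ball_lt_top.ne
  have hV : volume (Metric.ball (0 : EuclideanSpace ℝ (Fin n)) 1) = ENNReal.ofReal V :=
    (ENNReal.ofReal_toReal measure_ball_lt_top.ne).symm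
  obtain ⟨C', hC'0, hC'⟩ := exists_sum_le_of_sum_pow_le (n := n) (by omega)
    (C := 8 ^ n * (2 * (M + 1)) ^ n) (by positivity)
  refine ⟨hx₀, 1 / (C' + 1), by positivity, fun x hx => ?_⟩
  obtain ⟨γ, hγ, hγΩ, hγ0, hγ1, hγM⟩ := hM x hx
  obtain ⟨m, hm, hmle⟩ := exists_pos_le_bdryDist hΩ hfr (isCompact_Icc.image_of_continuousOn hγ)
    (image_subset_iff.2 hγΩ)
  obtain ⟨N, u, hu0, humem, hudist, husep, huend⟩ := exists_chain (f := γ)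
    (r := fun τ => bdryDist Ω (γ τ) / 2) (m := m / 2) zero_le_one hγ (by positivity)
    (fun τ hτ => by linarith [hmle _ (mem_image_of_mem γ hτ)])
  set z : ℕ → EuclideanSpace ℝ (Fin n) := fun k => γ (u k) with hz
  set g : ℕ → ℝ := fun k => bdryDist Ω (z k) with hg
  have hzΩ : ∀ k ≤ N, z k ∈ Ω := fun k hk => hγΩ (humem k hk)
  have hg0 : ∀ k ≤ N, 0 < g k := fun k hk => bdryDist_pos hΩ hfr (hzΩ k hk)
  have hsep : ∀ k j, k < j → j ≤ N → g k / 8 + g j / 8 ≤ dist (z k) (z j) := by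
    intro k j hkj hj
    have h1 : g k / 2 ≤ dist (z j) (z k) :=
      (husep k j hkj hj).2 (u j) ⟨le_rfl, (humem j hj).2⟩
    have h2 : g j ≤ g k + dist (z j) (z k) := bdryDist_le_add_dist
    rw [dist_comm] at h1 h2
    linarith [dist_nonneg (x := z k) (y := z j)]
  have hsums : ∀ k ≤ N, ∑ j ∈ Finset.range k, |g j| ^ n
      ≤ (8 ^ n * (2 * (M + 1)) ^ n) * |g k| ^ n := by
    intro k hk
    have hgk := hg0 k hk
    have hpack := sum_pow_le_of_disjoint_balls (s := Finset.range k) (z := z)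
      (ρ := fun j => g j / 8) (B := (2 * (M + 1) * g k) ^ n * V)
      (S := Metric.closedBall (z k) (2 * (M + 1) * g k))
      (fun j hj => by
        have := hg0 j (by have := Finset.mem_range.1 hj; omega)
        positivity) ?_ ?_ (by positivity) ?_
    · rw [mul_div_assoc, div_self hV0.ne', mul_one] at hpack
      have heq : ∑ j ∈ Finset.range k, |g j| ^ n
          = 8 ^ n * ∑ j ∈ Finset.range k, (g j / 8) ^ n := by
        rw [Finset.mul_sum]
        refine Finset.sum_congr rfl fun j hj => ?_
        rw [abs_of_pos (hg0 j (by have := Finset.mem_range.1 hj; omega)), div_pow]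
        field_simp
      rw [heq, abs_of_pos hgk]
      calc _ ≤ 8 ^ n * (2 * (M + 1) * g k) ^ n := mul_le_mul_of_nonneg_left hpack (by positivity)
        _ = _ := by rw [mul_pow (2 * (M + 1))]; ring
    · intro i hi j hj hij
      have hi' := Finset.mem_range.1 hi
      have hj' := Finset.mem_range.1 hj
      rcases lt_or_gt_of_ne hij with h | h
      · exact hsep i j h (by omega)
      · rw [add_comm, dist_comm]
        exact hsep j i h (by omega)
    · intro j hj w hw
      have hj' := Finset.mem_range.1 hj
      have h1 : dist (z j) (z k) ≤ M * g k :=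
        hγM (u j) (u k) (humem j (by omega)).1 (husep j k hj' hk).1 (humem k hk).2
      have h2 : g j ≤ g k + dist (z j) (z k) := bdryDist_le_add_dist
      have h3 : dist w (z j) < g j / 8 := hw
      have h4 : dist w (z k) ≤ dist w (z j) + dist (z j) (z k) := dist_triangle _ _ _
      have h5 : 0 ≤ M * g k := by positivity
      rw [Metric.mem_closedBall]
      linarith
    · rw [Measure.addHaar_closedBall _ _ (by positivity), hV,
        ← ENNReal.ofReal_mul (by positivity)]
      simp
  have hlen := hC' N (fun j => |g j|) (fun _ => abs_nonneg _) hsums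
  set w : ℕ → EuclideanSpace ℝ (Fin n) := fun k => if k ≤ N then z k else x₀ with hw
  have hwz : ∀ k ≤ N, w k = z k := fun k hk => by simp [hw, hk]
  have hwdist : ∀ k ≤ N, dist (w (k + 1)) (w k) ≤ g k / 2 := by
    intro k hk
    rw [hwz k hk]
    rcases eq_or_lt_of_le hk with rfl | h
    · simpa [hw, ← hγ1] using huend
    · rw [hwz (k + 1) h]
      exact hudist k h
  obtain ⟨l, σ, hl, -, hσ, hσ0, hσl, hσpos⟩ := exists_unitSpeed_polygon w (N + 1)
  have hw0 : w 0 = x := by simp [hw, hz, hu0, hγ0]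
  refine ⟨l, σ, hl, hσ, hσ0.trans hw0, by simp [hσl, hw], fun t ht => ?_⟩
  rcases hσpos t ht with rfl | ⟨k, hk, hkd, hkt⟩
  · rw [hσ0, hw0, mul_zero]
    exact ⟨hx, bdryDist_nonneg⟩
  have hkN : k ≤ N := by omega
  have hgk := hg0 k hkN
  have hdist : dist (σ t) (z k) ≤ g k / 2 := by
    rw [← hwz k hkN]
    exact hkd.trans (hwdist k hkN)
  refine ⟨ball_bdryDist_subset hΩ (hzΩ k hkN) (Metric.mem_ball.2 ?_), ?_⟩
  · change dist (σ t) (z k) < g k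
    linarith
  have hρ : g k ≤ bdryDist Ω (σ t) + dist (z k) (σ t) := bdryDist_le_add_dist
  rw [dist_comm] at hρ
  have hlk := hlen k hkN
  rw [abs_of_pos hgk] at hlk
  have htk : t ≤ (C' + 1) * (g k / 2) := by
    calc t ≤ _ := hkt
      _ ≤ ∑ j ∈ Finset.range (k + 1), |g j| / 2 := Finset.sum_le_sum fun j hj =>
          (hwdist j (by have := Finset.mem_range.1 hj; omega)).trans (by linarith [le_abs_self (g j)])
      _ = (∑ j ∈ Finset.range k, |g j| + g k) / 2 := by
          rw [Finset.sum_range_succ, abs_of_pos hgk, ← Finset.sum_div]; ring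
      _ ≤ _ := by linarith
  rw [one_div, inv_mul_le_iff₀ (by positivity)]
  exact htk.trans (mul_le_mul_of_nonneg_left (by linarith) (by positivity))

end John

end KornJohn

theorem theorem5p2 (n : ℕ) (hn : 2 ≤ n)
    (Ω Q : Set (EuclideanSpace ℝ (Fin n)))
    (hΩ_open : IsOpen Ω) (hΩ_conn : IsConnected Ω) (hΩ_bdd : Bornology.IsBounded Ω)
    (p : ℝ≥0∞) (hp : 1 < p) (hp' : p < ⊤)
    (hQ : KornJohn.IsClosedCube Q) (hQΩ : Q ⊆ Ω)
    (hKorn : KornJohn.KornInequality Ω Q p)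
    (x₀ : EuclideanSpace ℝ (Fin n)) (hsep : KornJohn.HasSeparationProperty Ω x₀) :
    KornJohn.IsJohn Ω x₀ := by
  obtain ⟨hx₀, C, hC, hcurve⟩ := hsep
  have hfr := KornJohn.frontier_nonempty_of_isBounded hn hΩ_bdd hΩ_conn.nonempty
  obtain ⟨K, hK0, hK⟩ := KornJohn.exists_volume_component_le hn hp hp' hΩ_open hΩ_conn hΩ_bdd hQ hQΩ
    hKorn hx₀ hC
  obtain ⟨M, hM0, hM⟩ :=
    KornJohn.exists_dist_le_bdryDist_of_separation hn hΩ_open hfr hC hK0 hK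
  refine KornJohn.isJohn_of_dist_le_bdryDist hn hΩ_open hfr hx₀ hM0 fun x hx => ?_
  obtain ⟨γ, hγ, hγΩ, h0, h1, hγsep⟩ := hcurve x hx
  exact ⟨γ, hγ, hγΩ, h0, h1, hM γ hγ hγΩ hγsep⟩
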